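/- Let $\Delta$ be a simplicial complex with vertex set $V=\{v_1,\dots,v_n\}$, $n\ge 1$ (every $\{v_j\}$ is a face, and $\emptyset$ is a face of dimension $-1$; a face $F$ has dimension $|F|-1$). Let $K$ be a field, $R=K[x_1,\dots,x_n]$, and let $I\subset R$ be the facet ideal of $\Delta$, generated by the monomials $\prod_{v_j\in F}x_j$ with $F$ a facet (maximal face) of $\Delta$. Write $\mathcal F(\Delta)$ for the set of facets. A subcomplex of $\Delta$ is a simplicial complex $\Gamma$ with $\mathcal F(\Gamma)\subseteq\mathcal F(\Delta)$. A facet $F$ of a complex $\Gamma$ is a leaf of $\Gamma$ if it is the only facet of $\Gamma$, or if there is a facet $G\ne F$ of $\Gamma$ such that $F\cap H\subseteq F\cap G$ for all facets $H\neq F$ of $\Gamma$. The complex $\Delta$ is a tree if any two of its facets are joined by a sequence of facets in which consecutive ones intersect, and every nonempty subcomplex of $\Delta$ has a leaf. A tree $\Delta$ is a linear tree if $I$ has a linear resolution, that is, for some $t$ the $i$-th module of the minimal graded free resolution of $R/I$ is a direct sum of copies of $R(-(t+i-1))$ for every $i\ge1$. Let $b_i(R/I)$ denote the $i$-th total Betti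 number of $R/I$, the rank of the $i$-th module in the minimal graded free resolution of $R/I$ over $R$. If $\Delta$ is a $d$-dimensional linear tree with $m$ facets, then $$b_1(R/I)=m\qquad\text{and}\qquad b_i(R/I)=\sum_{G}\binom{m(G)}{i}\quad\text{for all } i\ge 2,$$ where the sum runs over all $(d-1)$-dimensional faces $G$ of $\Delta$, and $m(G)=|\{F\in\mathcal F(\Delta): G\subseteq F\}|$. -/

import Mathlib

noncomputable section

namespace FacetIdeal

/-! ### Simplicial complexes, leaves and trees

Mathlib's complexes consist of nonempty faces; the empty face, of dimension `-1`, is added in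
`IsFace` below. An `AbstractSimplicialComplex V` has every element of `V` as a vertex. -/

section Complex

variable {V : Type*}

/-- The facets: the faces that are maximal under inclusion. -/
def facets (Δ : PreAbstractSimplicialComplex V) : Set (Finset V) :=
  {F | Maximal (fun G => G ∈ Δ) F}

/-- The faces of `Δ`, the empty face included. -/
def IsFace (Δ : PreAbstractSimplicialComplex V) (G : Finset V) : Prop :=
  G = ∅ ∨ G ∈ Δ

/-- The dimension `|F| - 1` of a face. -/
def faceDim (F : Finset V) : ℤ := (F.card : ℤ) - 1

/-- `dim Δ = d`: the largest dimension of a face of `Δ` is `d`. -/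
def HasDim (Δ : PreAbstractSimplicialComplex V) (d : ℤ) : Prop :=
  IsGreatest {k | ∃ F, IsFace Δ F ∧ faceDim F = k} d

open Classical in
/-- The finite set of faces of dimension `k`. -/
def facesOfDim [Fintype V] (Δ : PreAbstractSimplicialComplex V) (k : ℤ) : Finset (Finset V) :=
  {G : Finset V | IsFace Δ G ∧ faceDim G = k}

/-- The number of facets that contain `G`. -/
def numFacetsContaining (Δ : PreAbstractSimplicialComplex V) (G : Finset V) : ℕ :=
  {F | F ∈ facets Δ ∧ G ⊆ F}.ncard

variable [DecidableEq V]

/-- Any two facets are joined by a chain of facets in which consecutive ones intersect. -/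
def IsConnected (Δ : PreAbstractSimplicialComplex V) : Prop :=
  ∀ F ∈ facets Δ, ∀ G ∈ facets Δ,
    Relation.ReflTransGen
      (fun A B : Finset V => A ∈ facets Δ ∧ B ∈ facets Δ ∧ (A ∩ B).Nonempty) F G

/-- A facet `F` is a leaf if it is the only facet, or if there is a facet `G ≠ F` such that
`F ∩ H ⊆ F ∩ G` for all facets `H ≠ F`. -/
def IsLeaf (Δ : PreAbstractSimplicialComplex V) (F : Finset V) : Prop :=
  F ∈ facets Δ ∧
    (facets Δ = {F} ∨
      ∃ G ∈ facets Δ, G ≠ F ∧ ∀ H ∈ facets Δ, H ≠ F → F ∩ H ⊆ F ∩ G)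

/-- A tree: a connected complex all of whose nonempty subcomplexes have a leaf, where a subcomplex
of `Δ` is a complex `Γ` whose facets are facets of `Δ`. -/
def IsTree (Δ : PreAbstractSimplicialComplex V) : Prop :=
  IsConnected Δ ∧
    ∀ Γ : PreAbstractSimplicialComplex V, (facets Γ).Nonempty → facets Γ ⊆ facets Δ →
      ∃ F, IsLeaf Γ F

end Complex

/-! ### Graded free resolutions and Betti numbers of `R/I`, where `R = K[x_v : v ∈ V]` -/

section Resolution

variable {V K : Type*} [Field K]

/-- `p` is homogeneous of degree `j`; for `j < 0` this means `p = 0`. -/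
def IsHomog (p : MvPolynomial V K) (j : ℤ) : Prop :=
  ∀ c ∈ p.support, (c.degree : ℤ) = j

/-- A graded free resolution `⋯ → F₂ → F₁ → F₀ → R/I → 0` of the cyclic module `R/I` by free
modules of finite rank: `Fᵢ = ⨁ₖ R(-aᵢₖ)` is `R ^ (rank i)` with its `k`-th basis vector in
degree `aᵢₖ = shift i k`, and all maps are homogeneous of degree `0`. -/
structure GradedFreeResolution (I : Ideal (MvPolynomial V K)) where
  rank : ℕ → ℕ
  shift : (i : ℕ) → Fin (rank i) → ℤ
  d : (i : ℕ) → (Fin (rank (i + 1)) → MvPolynomial V K) →ₗ[MvPolynomial V K]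
    (Fin (rank i) → MvPolynomial V K)
  aug : (Fin (rank 0) → MvPolynomial V K) →ₗ[MvPolynomial V K] (MvPolynomial V K ⧸ I)
  aug_surjective : Function.Surjective aug
  exact_aug : Function.Exact (d 0) aug
  exact : ∀ i, Function.Exact (d (i + 1)) (d i)
  aug_homogeneous : ∀ k, ∃ p : MvPolynomial V K,
    IsHomog p (shift 0 k) ∧ aug (Pi.single k 1) = Ideal.Quotient.mk I p
  d_homogeneous : ∀ i k l, IsHomog (d i (Pi.single l 1) k) (shift (i + 1) l - shift i k)

namespace GradedFreeResolution

variable {I : Ideal (MvPolynomial V K)}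

/-- Minimality: the entries of all differentials lie in the ideal generated by the variables. -/
def IsMinimal (F : GradedFreeResolution I) : Prop :=
  ∀ i k l, F.d i (Pi.single l 1) k ∈ Ideal.span (Set.range (MvPolynomial.X (R := K) (σ := V)))

end GradedFreeResolution

/-- The `i`-th total Betti number of `R/I` is `b`: the module `R/I` has a minimal graded free
resolution, and the `i`-th free module in every such resolution has rank `b`. -/
def IsBettiNumber (I : Ideal (MvPolynomial V K)) (i b : ℕ) : Prop :=
  (∃ F : GradedFreeResolution I, F.IsMinimal) ∧
    ∀ F : GradedFreeResolution I, F.IsMinimal → F.rank i = b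

/-- `I` has a linear resolution: for some `t`, the `i`-th module in the minimal graded free
resolution of `R/I` is a direct sum of copies of `R(-(t + i - 1))`, for each `i ≥ 1`; that is,
`I` is generated in degree `t` and all maps in its own minimal resolution have linear entries. -/
def HasLinearResolution (I : Ideal (MvPolynomial V K)) : Prop :=
  ∃ F : GradedFreeResolution I, F.IsMinimal ∧
    ∃ t : ℤ, ∀ i, 1 ≤ i → ∀ k : Fin (F.rank i), F.shift i k = t + i - 1

/-- The facet ideal, generated by the squarefree monomials `∏_{v ∈ F} x_v`, `F` a facet. -/
def facetIdeal (K : Type*) [Field K] (Δ : PreAbstractSimplicialComplex V) :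
    Ideal (MvPolynomial V K) :=
  Ideal.span {f | ∃ F ∈ facets Δ, f = ∏ v ∈ F, MvPolynomial.X v}

/-- A linear tree (over `K`): a tree whose facet ideal has a linear resolution. -/
def IsLinearTree (K : Type*) [Field K] [DecidableEq V] (Δ : PreAbstractSimplicialComplex V) :
    Prop :=
  IsTree Δ ∧ HasLinearResolution (facetIdeal K Δ)

end Resolution

end FacetIdeal

end

/-! A linear resolution has no cancellation in its Hilbert series: with `m` generators of degree
`t`, the series of `I` is `z ^ t * Q(z) / (1 - z) ^ n`, and the `i`-th coefficient of `Q` is `(-1) ^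
i * b_{i+1}(R/I)` (`LinearChain.rank_eq_coeff`). So it suffices to compute `Q`, by removing facets
one at a time.

Linear first syzygies imply that two facets `F`, `H` are joined by a chain of facets inside `F ∪ H`
that exchanges at most one vertex at each step (`LinearChain.linearlyLinked`). Together with the
leaves of a tree this yields a facet `F = E ∪ {v}` whose vertex `v` is in no other facet, such that
the colon by `x_F` of the ideal of the other facets is generated by the variables `x_w` with `w ∉ F`
and `E ∪ {w}` a facet (`exists_linear_leaf`). If there are `r` such variables, `F` adds `(1 - z) ^
r` to `Q` (`idealSeries_insert`).

On the other side, adding `F` raises `m(E)` from `r` to `r + 1`, which by Pascal's rule adds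
`r.choose (i - 1)` to the sum of the `(m(G)).choose i`; no other ridge counts (`ridgeSum_insert`).
The two recursions agree (`exists_idealSeries_eq`). Independence of the chosen minimal resolution is
`GradedFreeResolution.IsMinimal.rank_eq`. -/

namespace FacetIdeal

/-! ### Linear leaves and the Hilbert series of a squarefree monomial ideal -/

section Combinatorics

open Finset

variable {V : Type*} [DecidableEq V]

/-- The exponent vector of the squarefree monomial with support `F`. -/
noncomputable def sqfreeExp {V : Type*} (F : Finset V) : V →₀ ℕ := Finsupp.indicator F fun _ _ => 1

lemma sqfreeExp_apply (F : Finset V) (v : V) : sqfreeExp F v = if v ∈ F then 1 else 0 := by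
  classical
  simp [sqfreeExp, Finsupp.indicator_apply]

lemma support_sqfreeExp (F : Finset V) : (sqfreeExp F).support = F := by
  ext v
  simp [sqfreeExp_apply]

lemma sqfreeExp_injective : Function.Injective (sqfreeExp : Finset V → V →₀ ℕ) := fun F G h => by
  rw [← support_sqfreeExp F, h, support_sqfreeExp]

lemma sqfreeExp_le_iff {F : Finset V} {c : V →₀ ℕ} : sqfreeExp F ≤ c ↔ F ⊆ c.support := by
  rw [Finsupp.le_def]
  constructor
  · intro h v hv
    have := h v
    rw [sqfreeExp_apply, if_pos hv] at this
    simp only [Finsupp.mem_support_iff]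
    omega
  · intro h v
    rw [sqfreeExp_apply]
    split_ifs with hv
    · have := h hv
      simp only [Finsupp.mem_support_iff] at this
      omega
    · exact Nat.zero_le _

lemma degree_sqfreeExp (F : Finset V) : (sqfreeExp F).degree = #F := by
  rw [Finsupp.degree_apply, support_sqfreeExp]
  rw [Finset.sum_congr rfl (g := fun _ => 1) fun v hv => by rw [sqfreeExp_apply, if_pos hv]]
  simp

lemma sqfreeExp_add_sdiff (F G : Finset V) :
    sqfreeExp (G \ F) + sqfreeExp F = sqfreeExp (F ∪ G) := by
  ext v
  simp only [Finsupp.add_apply, sqfreeExp_apply, mem_sdiff, mem_union]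
  by_cases h1 : v ∈ F <;> by_cases h2 : v ∈ G <;> simp [h1, h2]

/-- The exponents of degree `j` of the monomials in the ideal generated by the squarefree
monomials with supports in `S`. -/
noncomputable def idealExps [Fintype V] (S : Finset (Finset V)) (j : ℕ) : Finset (V →₀ ℕ) :=
  {c ∈ (univ : Finset V).finsuppAntidiag j | ∃ F ∈ S, F ⊆ c.support}

lemma mem_idealExps [Fintype V] {S : Finset (Finset V)} {j : ℕ} {c : V →₀ ℕ} :
    c ∈ idealExps S j ↔ c.degree = j ∧ ∃ F ∈ S, F ⊆ c.support := by
  simp [idealExps, Finsupp.degree_eq_sum]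

/-- If the monomial of `F` modulo the ideal of `S` has annihilator generated by the variables
in `W`, adding `F` to `S` adds the multiples of `F` by monomials without variables in `W`. -/
lemma card_idealExps_insert [Fintype V] {S : Finset (Finset V)} {F W : Finset V} {t : ℕ}
    (hF : #F = t) (hW : ∀ w ∈ W, w ∉ F ∧ ∃ H ∈ S, H ⊆ insert w F)
    (hS : ∀ H ∈ S, ∃ w ∈ W, w ∈ H) (s : ℕ) :
    #(idealExps (insert F S) (t + s)) =
      #(idealExps S (t + s)) + #((univ \ W).finsuppAntidiag s) := by
  have hsub : idealExps S (t + s) ⊆ idealExps (insert F S) (t + s) := by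
    intro c hc
    rw [mem_idealExps] at hc ⊢
    obtain ⟨h1, H, hH, h2⟩ := hc
    exact ⟨h1, H, mem_insert_of_mem hH, h2⟩
  rw [← card_sdiff_add_card_eq_card hsub, add_comm]
  congr 1
  symm
  refine card_bij (fun c _ => c + sqfreeExp F) ?_ ?_ ?_
  · intro c hc
    rw [mem_finsuppAntidiag'] at hc
    have hcs : c.degree = s := by rw [← hc.1]; rfl
    rw [mem_sdiff, mem_idealExps, mem_idealExps]
    refine ⟨⟨by rw [map_add, degree_sqfreeExp, hF, hcs, add_comm], F, mem_insert_self _ _, ?_⟩, ?_⟩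
    · rw [← sqfreeExp_le_iff]
      exact le_add_self
    · rintro ⟨-, H, hH, hHc⟩
      -- The variable `w` divides neither the cofactor `c` nor the monomial of `F`, so the product
      -- is not a multiple of the monomial of `H`.
      obtain ⟨w, hw, hwH⟩ := hS H hH
      have h1 := hHc hwH
      have h2 : w ∉ c.support := fun h => (mem_sdiff.1 (hc.2 h)).2 hw
      rw [Finsupp.mem_support_iff, Finsupp.add_apply, sqfreeExp_apply, if_neg (hW w hw).1] at h1
      rw [Finsupp.notMem_support_iff] at h2
      exact h1 (by rw [h2, add_zero])
  · intro a _ b _ h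
    exact add_right_cancel h
  · intro c hc
    rw [mem_sdiff, mem_idealExps, mem_idealExps] at hc
    obtain ⟨⟨h1, H, hH, hHc⟩, h2⟩ := hc
    have hHF : H = F := by
      rcases mem_insert.1 hH with h | h
      · exact h
      · exact absurd ⟨h1, H, h, hHc⟩ h2
    subst hHF
    have hle := sqfreeExp_le_iff.2 hHc
    refine ⟨c - sqfreeExp H, ?_, tsub_add_cancel_of_le hle⟩
    rw [mem_finsuppAntidiag']
    constructor
    · change (c - sqfreeExp H).degree = s
      have : (c - sqfreeExp H).degree + (sqfreeExp H).degree = c.degree := by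
        rw [← map_add, tsub_add_cancel_of_le hle]
      rw [degree_sqfreeExp] at this
      omega
    · intro w hw
      rw [mem_sdiff]
      -- A variable `w ∈ W` in the cofactor would put `insert w F`, hence a member of `S`, inside
      -- the support.
      refine ⟨mem_univ _, fun hwW => h2 ⟨h1, ?_⟩⟩
      obtain ⟨hwF, H', hH', hsub'⟩ := hW w hwW
      refine ⟨H', hH', hsub'.trans (insert_subset ?_ hHc)⟩
      rw [Finsupp.mem_support_iff, Finsupp.tsub_apply, sqfreeExp_apply, if_neg hwF] at hw
      rw [Finsupp.mem_support_iff]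
      simpa using hw

/-- The Hilbert series of the ideal generated by the squarefree monomials with supports in `S`,
shifted by `t`. -/
noncomputable def idealSeries [Fintype V] (S : Finset (Finset V)) (t : ℕ) : PowerSeries ℤ :=
  PowerSeries.mk fun s => (#(idealExps S (t + s)) : ℤ)

/-- The Hilbert series of a polynomial ring in `k` variables. -/
noncomputable def polySeries (k : ℕ) : PowerSeries ℤ := (PowerSeries.invOneSubPow ℤ k).val

lemma coeff_polySeries (T : Finset V) (s : ℕ) :
    PowerSeries.coeff s (polySeries #T) = (#(T.finsuppAntidiag s) : ℤ) := by
  rw [card_finsuppAntidiag_nat_eq_multichoose, polySeries]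
  -- The binomial formula for the coefficients starts at one variable; with no variables the series
  -- is `1`.
  cases h : #T with
  | zero =>
    cases s with
    | zero => simp [PowerSeries.invOneSubPow_zero]
    | succ s => simp [PowerSeries.invOneSubPow_zero, PowerSeries.coeff_one]
  | succ k =>
    rw [PowerSeries.invOneSubPow_val_succ_eq_mk_add_choose, PowerSeries.coeff_mk,
      Nat.multichoose_eq, Nat.add_right_comm, Nat.add_sub_cancel, Nat.choose_symm_add]

lemma polySeries_sub_card [Fintype V] (W : Finset V) :
    polySeries #(univ \ W) = polySeries (Fintype.card V) * (1 - PowerSeries.X) ^ #W := by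
  have h : #(univ \ W) + #W = Fintype.card V := by
    rw [card_sdiff_add_card_eq_card (subset_univ W), card_univ]
  rw [← h, polySeries, polySeries, mul_comm,
    PowerSeries.one_sub_pow_mul_invOneSubPow_val_add_eq_invOneSubPow_val]

lemma isUnit_polySeries (k : ℕ) : IsUnit (polySeries k) := (PowerSeries.invOneSubPow ℤ k).isUnit

lemma coeff_one_sub_X_pow (r i : ℕ) :
    PowerSeries.coeff i ((1 - PowerSeries.X : PowerSeries ℤ) ^ r) = (-1) ^ i * (r.choose i : ℤ) := by
  have h : (1 - PowerSeries.X : PowerSeries ℤ) ^ r =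
      PowerSeries.evalNegHom ((((1 + Polynomial.X) ^ r : Polynomial ℤ) : PowerSeries ℤ)) := by
    rw [Polynomial.coe_pow, Polynomial.coe_add, Polynomial.coe_one, Polynomial.coe_X, map_pow,
      map_add, map_one, PowerSeries.evalNegHom_X, sub_eq_add_neg]
  rw [h, PowerSeries.evalNegHom, PowerSeries.coeff_rescale, Polynomial.coeff_coe,
    Polynomial.coeff_one_add_X_pow]

/-- The colon ideal is generated by the variables in `W`, so the quotient of the two ideals is a
shifted polynomial ring in the remaining variables; omitting `#W` variables multiplies its series by
`(1 - X) ^ #W`. -/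
lemma idealSeries_insert [Fintype V] {S : Finset (Finset V)} {F W : Finset V} {t : ℕ}
    (hF : #F = t) (hW : ∀ w ∈ W, w ∉ F ∧ ∃ H ∈ S, H ⊆ insert w F)
    (hS : ∀ H ∈ S, ∃ w ∈ W, w ∈ H) :
    idealSeries (insert F S) t = idealSeries S t +
      polySeries (Fintype.card V) * (1 - PowerSeries.X) ^ #W := by
  ext s
  rw [map_add, ← polySeries_sub_card, coeff_polySeries, idealSeries, idealSeries,
    PowerSeries.coeff_mk, PowerSeries.coeff_mk, card_idealExps_insert hF hW hS]
  push_cast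
  rfl

/-- Every nonempty subfamily of `S` has a leaf. -/
def HasLeaves (S : Finset (Finset V)) : Prop :=
  ∀ T ⊆ S, T.Nonempty → ∃ F ∈ T, T = {F} ∨ ∃ G ∈ T, G ≠ F ∧ ∀ H ∈ T, H ≠ F → F ∩ H ⊆ F ∩ G

/-- Two members `F`, `H` of `S` are joined by a chain of members inside `F ∪ H` in which the union
of two consecutive ones has at most `t + 1` elements. -/
def LinearlyLinked (S : Finset (Finset V)) (t : ℕ) : Prop :=
  ∀ F ∈ S, ∀ H ∈ S, Relation.ReflTransGen
    (fun A B => A ∈ S ∧ B ∈ S ∧ A ⊆ F ∪ H ∧ B ⊆ F ∪ H ∧ #(A ∪ B) ≤ t + 1) F H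

/-- The first member of the chain that differs from `F` works; the chain may stay at `F` for some
steps before. -/
lemma LinearlyLinked.exists_adjacent {S : Finset (Finset V)} {t : ℕ} (hS : LinearlyLinked S t)
    {F H : Finset V} (hF : F ∈ S) (hH : H ∈ S) (hne : H ≠ F) :
    ∃ A ∈ S, A ≠ F ∧ A ⊆ F ∪ H ∧ #(F ∪ A) ≤ t + 1 := by
  suffices h : ∀ B, Relation.ReflTransGen
      (fun A B => A ∈ S ∧ B ∈ S ∧ A ⊆ F ∪ H ∧ B ⊆ F ∪ H ∧ #(A ∪ B) ≤ t + 1) F B →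
      B = F ∨ ∃ A ∈ S, A ≠ F ∧ A ⊆ F ∪ H ∧ #(F ∪ A) ≤ t + 1 from
    (h H (hS F hF H hH)).resolve_left hne
  intro B hB
  induction hB with
  | refl => exact Or.inl rfl
  | @tail A B _ hAB ih =>
    rcases ih with rfl | h
    · by_cases hBA : B = A
      · exact Or.inl hBA
      · exact Or.inr ⟨B, hAB.2.1, hBA, hAB.2.2.2.1, hAB.2.2.2.2⟩
    · exact Or.inr h

lemma exists_insert_eq_of_card_union_le {F A : Finset V} {d : ℕ} (hF : #F = d + 1)
    (hA : #A = d + 1) (hne : A ≠ F) (h : #(F ∪ A) ≤ d + 1 + 1) :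
    #(F ∩ A) = d ∧ ∃ w ∉ F, A = insert w (F ∩ A) := by
  have h1 := card_union_add_card_inter F A
  have h2 : #(F ∩ A) < d + 1 := by
    by_contra h3
    have h4 : F ∩ A = A := eq_of_subset_of_card_le inter_subset_right (by omega)
    exact hne (eq_of_subset_of_card_le (inter_eq_right.1 h4) (by omega))
  have h3 : #(F ∩ A) = d := by omega
  refine ⟨h3, ?_⟩
  have h4 : #(A \ F) = 1 := by
    have := card_sdiff_add_card_inter A F
    rw [inter_comm] at this
    omega
  obtain ⟨w, hw⟩ := card_eq_one.1 h4
  have hwA : w ∈ A \ F := by rw [hw]; exact mem_singleton_self w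
  refine ⟨w, (mem_sdiff.1 hwA).2, ?_⟩
  rw [← sdiff_union_inter A F, hw, inter_comm A F]
  ext x
  simp only [mem_union, mem_singleton, mem_insert, mem_inter]
  have := (mem_sdiff.1 hwA).2
  constructor
  · rintro (rfl | ⟨h1, h2⟩)
    · exact Or.inl rfl
    · exact Or.inr ⟨h1, Or.inr ⟨h1, h2⟩⟩
  · rintro (rfl | ⟨h1, rfl | ⟨_, h3⟩⟩)
    · exact Or.inl rfl
    · exact Or.inl rfl
    · exact Or.inr ⟨h1, h3⟩

/-- A linearly linked family with leaves has a member `F = E ∪ {v}` such that `v` lies in no other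
member, and every other member contains some `w ∉ F` for which `E ∪ {w}` is a member. -/
lemma exists_linear_leaf {S : Finset (Finset V)} {d : ℕ} (hne : S.Nonempty)
    (hcard : ∀ F ∈ S, #F = d + 1) (hleaf : HasLeaves S) (hlink : LinearlyLinked S (d + 1)) :
    ∃ (E : Finset V) (v : V), v ∉ E ∧ insert v E ∈ S ∧
      ∀ H ∈ S, H ≠ insert v E → v ∉ H ∧ ∃ w ∈ H, w ∉ insert v E ∧ insert w E ∈ S := by
  obtain ⟨F, hF, h | ⟨G, hG, hGF, hmax⟩⟩ := hleaf S Subset.rfl hne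
  · obtain ⟨v, hv⟩ : F.Nonempty := card_pos.1 (by rw [hcard F hF]; omega)
    refine ⟨F.erase v, v, notMem_erase v F, by rwa [insert_erase hv], fun H hH hHF => ?_⟩
    rw [h, mem_singleton] at hH
    exact absurd (hH.trans (insert_erase hv).symm) hHF
  · have key : ∀ H ∈ S, H ≠ F → #(F ∩ G) = d ∧ ∃ w ∈ H, w ∉ F ∧ insert w (F ∩ G) ∈ S := by
      intro H hH hHF
      obtain ⟨A, hA, hAF, hAH, hle⟩ := hlink.exists_adjacent hF hH hHF
      obtain ⟨h1, w, hw, hAw⟩ :=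
        exists_insert_eq_of_card_union_le (hcard F hF) (hcard A hA) hAF hle
      have hGlt : #(F ∩ G) ≤ d := by
        have h3 : #(F ∩ G) < #F := card_lt_card
          ⟨inter_subset_left, fun h4 => hGF (eq_of_subset_of_card_le
            ((subset_inter_iff.1 h4).2) (by rw [hcard F hF, hcard G hG])).symm⟩
        rw [hcard F hF] at h3
        omega
      -- The leaf condition bounds `F ∩ A` by `F ∩ G`, and a neighbour `A` of `F` already meets it
      -- in `d` elements. So all neighbours share the ridge `F ∩ G`.
      have hEq : F ∩ A = F ∩ G := eq_of_subset_of_card_le (hmax A hA hAF) (by omega)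
      refine ⟨by rw [← hEq, h1], w, ?_, hw, by rw [← hEq, ← hAw]; exact hA⟩
      have hwA : w ∈ A := by rw [hAw]; exact mem_insert_self _ _
      exact (mem_union.1 (hAH hwA)).resolve_left hw
    have hE := (key G hG hGF).1
    obtain ⟨v, hv⟩ : ∃ v, F \ (F ∩ G) = {v} := card_eq_one.1 (by
      have := card_sdiff_add_card_eq_card (inter_subset_left : F ∩ G ⊆ F)
      rw [hcard F hF, hE] at this
      omega)
    have hvm : v ∈ F \ (F ∩ G) := by rw [hv]; exact mem_singleton_self v
    have hFE : insert v (F ∩ G) = F := by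
      rw [insert_eq, ← hv, sdiff_union_of_subset inter_subset_left]
    refine ⟨F ∩ G, v, (mem_sdiff.1 hvm).2, by rwa [hFE], fun H hH hHF => ?_⟩
    rw [hFE] at hHF ⊢
    refine ⟨fun hvH => (mem_sdiff.1 hvm).2 (hmax H hH hHF (mem_inter.2 ⟨(mem_sdiff.1 hvm).1, hvH⟩)),
      (key H hH hHF).2⟩

/-- `∑ (m(G) choose i)` over all `d`-element sets `G`, where `m(G)` is the number of members of `S`
that contain `G`. -/
def ridgeSum [Fintype V] (S : Finset (Finset V)) (d i : ℕ) : ℕ :=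
  ∑ G ∈ powersetCard d univ, (#{F ∈ S | G ⊆ F}).choose i

/-- Only the term at `E` changes, by Pascal's rule: the members above `E` correspond to the vertices
`w`. Lower index at least `2` is needed because the other ridges of the new member contribute
`Nat.choose 1 (i + 2) = 0`. -/
lemma ridgeSum_insert [Fintype V] {S : Finset (Finset V)} {E : Finset V} {v : V} {d : ℕ}
    (hE : #E = d) (hvE : v ∉ E) (hcard : ∀ H ∈ S, #H = d + 1) (hv : ∀ H ∈ S, v ∉ H) (i : ℕ) :
    ridgeSum (insert (insert v E) S) d (i + 2) =
      ridgeSum S d (i + 2) + (#{w | w ∉ insert v E ∧ insert w E ∈ S}).choose (i + 1) := by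
  have hnotMem : insert v E ∉ S := fun h => hv _ h (mem_insert_self _ _)
  have hcE : #{F ∈ S | E ⊆ F} = #{w | w ∉ insert v E ∧ insert w E ∈ S} := by
    symm
    refine card_bij (fun w _ => insert w E) ?_ ?_ ?_
    · intro w hw
      rw [mem_filter] at hw ⊢
      exact ⟨hw.2.2, subset_insert _ _⟩
    · intro a ha b hb h
      rw [mem_filter, mem_insert, not_or] at ha
      have h1 : a ∈ insert b E := h ▸ mem_insert_self a E
      exact (mem_insert.1 h1).resolve_right ha.2.1.2
    · intro H hH
      rw [mem_filter] at hH
      obtain ⟨w, hw⟩ : ∃ w, H \ E = {w} := card_eq_one.1 (by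
        have := card_sdiff_add_card_eq_card hH.2
        rw [hcard H hH.1, hE] at this
        omega)
      have hwm : w ∈ H \ E := by rw [hw]; exact mem_singleton_self w
      have hHE : insert w E = H := by
        rw [insert_eq, ← hw, sdiff_union_of_subset hH.2]
      refine ⟨w, ?_, hHE⟩
      rw [mem_filter, mem_insert, not_or, hHE]
      refine ⟨mem_univ _, ⟨?_, (mem_sdiff.1 hwm).2⟩, hH.1⟩
      rintro rfl
      exact hv H hH.1 (mem_sdiff.1 hwm).1
  have hmem : E ∈ powersetCard d (univ : Finset V) := mem_powersetCard.2 ⟨subset_univ _, hE⟩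
  have hterm : ∀ G ∈ powersetCard d (univ : Finset V),
      (#{F ∈ insert (insert v E) S | G ⊆ F}).choose (i + 2) =
      (#{F ∈ S | G ⊆ F}).choose (i + 2) +
        if G = E then (#{F ∈ S | E ⊆ F}).choose (i + 1) else 0 := by
    intro G hG
    have hGd := (mem_powersetCard.1 hG).2
    rw [filter_insert]
    by_cases hGE : G = E
    · subst hGE
      rw [if_pos (subset_insert _ _), if_pos rfl,
        card_insert_of_notMem (fun h => hnotMem (mem_filter.1 h).1), Nat.choose_succ_succ, add_comm]
    · rw [if_neg hGE, add_zero]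
      split_ifs with hsub
      -- A ridge of the new member other than `E` contains `v`, so no old member contains it.
      · have hvG : v ∈ G := by
          by_contra h
          refine hGE (eq_of_subset_of_card_le (fun x hx => ?_) (by omega))
          exact (mem_insert.1 (hsub hx)).resolve_left fun hxv => h (hxv ▸ hx)
        have h0 : ({F ∈ S | G ⊆ F} : Finset (Finset V)) = ∅ :=
          filter_eq_empty_iff.2 fun H hH hGH => hv H hH (hGH hvG)
        rw [h0]
        simp [Nat.choose_eq_zero_of_lt]
      · rfl
  rw [ridgeSum, sum_congr rfl hterm, sum_add_distrib, sum_ite_eq', if_pos hmem, hcE, ridgeSum]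

/-- Induction on the number of members, removing a linear leaf. `Q` is a sum of powers `(1 - X) ^
#W`, one for each removal. -/
theorem exists_idealSeries_eq [Fintype V] {d : ℕ} : ∀ {S : Finset (Finset V)},
    (∀ F ∈ S, #F = d + 1) → HasLeaves S → LinearlyLinked S (d + 1) →
    ∃ Q : PowerSeries ℤ, idealSeries S (d + 1) = polySeries (Fintype.card V) * Q ∧
      PowerSeries.coeff 0 Q = #S ∧
      ∀ i, PowerSeries.coeff (i + 1) Q = (-1) ^ (i + 1) * (ridgeSum S d (i + 2) : ℤ) := by
  intro S
  induction hn : #S generalizing S with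
  | zero =>
    intro _ _ _
    rw [card_eq_zero] at hn
    subst hn
    refine ⟨0, ?_, by simp, fun i => by simp [ridgeSum]⟩
    ext s
    simp [idealSeries, idealExps]
  | succ n ih =>
    intro hcard hleaf hlink
    obtain ⟨E, v, hvE, hES, hS⟩ :=
      exists_linear_leaf (card_pos.1 (by omega)) hcard hleaf hlink
    have hE : #E = d := by
      have := hcard _ hES
      rw [card_insert_of_notMem hvE] at this
      omega
    obtain ⟨S', hS', hins⟩ : ∃ S', insert v E ∉ S' ∧ insert (insert v E) S' = S :=
      ⟨S.erase (insert v E), notMem_erase _ _, insert_erase hES⟩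
    have hsub : S' ⊆ S := hins ▸ subset_insert _ _
    have hne : ∀ H ∈ S', H ≠ insert v E := fun H hH h => hS' (h ▸ hH)
    have hv : ∀ H ∈ S', v ∉ H := fun H hH => (hS H (hsub hH) (hne H hH)).1
    have hmemS' : ∀ A ∈ S, v ∉ A → A ∈ S' := by
      intro A hA hvA
      rw [← hins] at hA
      exact (mem_insert.1 hA).resolve_left fun h => hvA (h ▸ mem_insert_self _ _)
    -- Chains between members without `v` stay inside their union, hence never pass through the
    -- removed leaf.
    have hlink' : LinearlyLinked S' (d + 1) := by
      intro F hF H hH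
      refine Relation.ReflTransGen.mono ?_ F H (hlink F (hsub hF) H (hsub hH))
      rintro A B ⟨hA, hB, hA', hB', hAB⟩
      have hvFH : v ∉ F ∪ H := by
        rw [mem_union, not_or]
        exact ⟨hv F hF, hv H hH⟩
      exact ⟨hmemS' A hA fun h => hvFH (hA' h), hmemS' B hB fun h => hvFH (hB' h), hA', hB', hAB⟩
    have hcard' : ∀ F ∈ S', #F = d + 1 := fun F hF => hcard F (hsub hF)
    have hn' : #S' = n := by
      have := card_insert_of_notMem hS'
      rw [hins] at this
      omega
    obtain ⟨Q, hQ, hQ0, hQi⟩ :=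
      ih hn' hcard' (fun T hT => hleaf T (hT.trans hsub)) hlink'
    set W : Finset V := {w | w ∉ insert v E ∧ insert w E ∈ S'} with hWdef
    have hseries := idealSeries_insert (S := S') (F := insert v E) (W := W) (hcard _ hES)
      (fun w hw => by
        rw [hWdef, mem_filter] at hw
        exact ⟨hw.2.1, _, hw.2.2, insert_subset_insert _ (subset_insert _ _)⟩)
      (fun H hH => by
        obtain ⟨_, w, hwH, hw, hwE⟩ := hS H (hsub hH) (hne H hH)
        refine ⟨w, ?_, hwH⟩
        rw [hWdef, mem_filter]
        refine ⟨mem_univ _, hw, hmemS' _ hwE ?_⟩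
        rw [mem_insert, not_or]
        exact ⟨fun h => hw (h ▸ mem_insert_self _ _), hvE⟩)
    rw [hins] at hseries
    refine ⟨Q + (1 - PowerSeries.X) ^ #W, by rw [hseries, hQ, mul_add], ?_, fun i => ?_⟩
    · rw [map_add, hQ0, coeff_one_sub_X_pow]
      simp
    · rw [map_add, hQi, coeff_one_sub_X_pow, ← hins, ridgeSum_insert hE hvE hcard' hv]
      push_cast
      ring

end Combinatorics

/-! ### Uniqueness of minimal ranks, and passage from `R/I` to `I` -/

section Comparison

open MvPolynomial

variable {V K : Type*} [Field K]

/-- A map out of a finite free module lifts through any map whose range contains its range. -/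
lemma exists_lift {R M N : Type*} [CommRing R] [AddCommGroup M] [Module R M] [AddCommGroup N]
    [Module R N] {r : ℕ} (f : (Fin r → R) →ₗ[R] N) (g : M →ₗ[R] N) (h : ∀ x, ∃ y, g y = f x) :
    ∃ l : (Fin r → R) →ₗ[R] M, ∀ x, g (l x) = f x := by
  choose s hs using h
  refine ⟨(Pi.basisFun R (Fin r)).constr R fun k => s (Pi.single k 1), fun x => ?_⟩
  have : g ∘ₗ (Pi.basisFun R (Fin r)).constr R (fun k => s (Pi.single k 1)) = f := by
    refine (Pi.basisFun R (Fin r)).ext fun k => ?_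
    rw [LinearMap.comp_apply, Module.Basis.constr_basis, hs, Pi.basisFun_apply]
  exact LinearMap.congr_fun this x

/-- The matrix of a map of free modules modulo the ideal of the variables. -/
noncomputable def matrixModVars {r s : ℕ}
    (f : (Fin r → MvPolynomial V K) →ₗ[MvPolynomial V K] (Fin s → MvPolynomial V K)) :
    Matrix (Fin s) (Fin r) K :=
  (LinearMap.toMatrix' f).map constantCoeff

lemma matrixModVars_apply {r s : ℕ}
    (f : (Fin r → MvPolynomial V K) →ₗ[MvPolynomial V K] (Fin s → MvPolynomial V K))
    (k : Fin s) (l : Fin r) : matrixModVars f k l = constantCoeff (f (Pi.single l 1) k) := by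
  rw [matrixModVars, Matrix.map_apply, LinearMap.toMatrix'_apply]

lemma matrixModVars_comp {r s u : ℕ}
    (f : (Fin s → MvPolynomial V K) →ₗ[MvPolynomial V K] (Fin u → MvPolynomial V K))
    (g : (Fin r → MvPolynomial V K) →ₗ[MvPolynomial V K] (Fin s → MvPolynomial V K)) :
    matrixModVars (f ∘ₗ g) = matrixModVars f * matrixModVars g := by
  rw [matrixModVars, LinearMap.toMatrix'_comp, Matrix.map_mul]
  rfl

lemma matrixModVars_add {r s : ℕ}
    (f g : (Fin r → MvPolynomial V K) →ₗ[MvPolynomial V K] (Fin s → MvPolynomial V K)) :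
    matrixModVars (f + g) = matrixModVars f + matrixModVars g := by
  ext k l
  simp [matrixModVars_apply]

lemma matrixModVars_id {r : ℕ} :
    matrixModVars (LinearMap.id : (Fin r → MvPolynomial V K) →ₗ[MvPolynomial V K] _) = 1 := by
  ext k l
  rw [matrixModVars_apply, LinearMap.id_apply, Pi.single_apply, Matrix.one_apply]
  split_ifs <;> simp

lemma le_of_matrix_mul_eq_one {r s : ℕ} {A : Matrix (Fin r) (Fin s) K}
    {B : Matrix (Fin s) (Fin r) K} (h : A * B = 1) : r ≤ s := by
  have h1 := Matrix.rank_mul_le_left A B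
  rw [h, Matrix.rank_one, Fintype.card_fin] at h1
  exact h1.trans ((Matrix.rank_le_width A))

lemma constantCoeff_eq_zero_of_mem_span {p : MvPolynomial V K}
    (hp : p ∈ Ideal.span (Set.range (X (R := K) (σ := V)))) : constantCoeff p = 0 := by
  have : Ideal.span (Set.range (X (R := K) (σ := V))) ≤
      RingHom.ker (constantCoeff (R := K) (σ := V)) := by
    rw [Ideal.span_le]
    rintro _ ⟨v, rfl⟩
    simp
  exact this hp

namespace GradedFreeResolution

variable {I : Ideal (MvPolynomial V K)}

lemma IsMinimal.matrixModVars_d {F : GradedFreeResolution I} (hF : F.IsMinimal) (i : ℕ) :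
    matrixModVars (F.d i) = 0 := by
  ext k l
  rw [matrixModVars_apply, constantCoeff_eq_zero_of_mem_span (hF i k l), Matrix.zero_apply]

/-- Comparison of two resolutions in degree `i`: maps `φ`, `ψ` compatible with the differentials,
such that `ψ ∘ φ` is homotopic to the identity. -/
lemma IsMinimal.exists_comparison {F : GradedFreeResolution I} (hF : F.IsMinimal)
    (F' : GradedFreeResolution I) (i : ℕ) :
    ∃ (φ : (Fin (F.rank i) → MvPolynomial V K) →ₗ[MvPolynomial V K] (Fin (F'.rank i) → _))
      (ψ : (Fin (F'.rank i) → MvPolynomial V K) →ₗ[MvPolynomial V K] (Fin (F.rank i) → _))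
      (h : (Fin (F.rank i) → MvPolynomial V K) →ₗ[MvPolynomial V K] (Fin (F.rank (i + 1)) → _))
      (e : (Fin (F.rank i) → MvPolynomial V K) →ₗ[MvPolynomial V K] (Fin (F.rank i) → _)),
      (∀ x, ∃ y, F'.d i y = φ (F.d i x)) ∧ (∀ x, ∃ y, F.d i y = ψ (F'.d i x)) ∧
      (∀ x, ψ (φ x) = x + F.d i (h x) + e x) ∧ (∀ x, e (F.d i x) = 0) ∧
      matrixModVars e = 0 := by
  induction i with
  | zero =>
    obtain ⟨φ, hφ⟩ := exists_lift F.aug F'.aug fun x => F'.aug_surjective _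
    obtain ⟨ψ, hψ⟩ := exists_lift F'.aug F.aug fun x => F.aug_surjective _
    obtain ⟨h, hh⟩ := exists_lift (ψ ∘ₗ φ - LinearMap.id) (F.d 0) fun x =>
      (F.exact_aug _).1 (by simp [hφ, hψ])
    refine ⟨φ, ψ, h, 0, fun x => (F'.exact_aug _).1 ?_, fun x => (F.exact_aug _).1 ?_,
      fun x => ?_, fun x => rfl, ?_⟩
    · rw [hφ]
      exact F.exact_aug.apply_apply_eq_zero x
    · rw [hψ]
      exact F'.exact_aug.apply_apply_eq_zero x
    · rw [hh]
      simp
    · ext k l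
      simp [matrixModVars_apply]
  | succ i ih =>
    obtain ⟨φ, ψ, h, e, hφ, hψ, hh, he, -⟩ := ih
    obtain ⟨φ', hφ'⟩ := exists_lift (φ ∘ₗ F.d i) (F'.d i) hφ
    obtain ⟨ψ', hψ'⟩ := exists_lift (ψ ∘ₗ F'.d i) (F.d i) hψ
    simp only [LinearMap.comp_apply] at hφ' hψ'
    -- This map has cycles as values: `d ψ' φ' = ψ φ d = d + d h d + e d`, and `e d = 0`.
    obtain ⟨h', hh'⟩ := exists_lift (ψ' ∘ₗ φ' - LinearMap.id - h ∘ₗ F.d i) (F.d (i + 1)) fun x =>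
      (F.exact i _).1 (by simp [hφ', hψ', hh, he])
    -- The new error term is the previous homotopy after the differential; it kills boundaries, and
    -- minimality makes it zero modulo the variables.
    refine ⟨φ', ψ', h', h ∘ₗ F.d i, fun x => (F'.exact i _).1 ?_, fun x => (F.exact i _).1 ?_,
      fun x => ?_, fun x => ?_, ?_⟩
    · rw [hφ', (F.exact i).apply_apply_eq_zero x, map_zero]
    · rw [hψ', (F'.exact i).apply_apply_eq_zero x, map_zero]
    · rw [hh']
      simp only [LinearMap.sub_apply, LinearMap.comp_apply, LinearMap.id_apply]
      abel
    · rw [LinearMap.comp_apply, (F.exact i).apply_apply_eq_zero x, map_zero]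
    · rw [matrixModVars_comp, hF.matrixModVars_d, Matrix.mul_zero]

/-- Modulo the variables the homotopy terms vanish, so the identity matrix factors through `K ^
F'.rank i`. -/
lemma IsMinimal.rank_le {F : GradedFreeResolution I} (hF : F.IsMinimal)
    (F' : GradedFreeResolution I) (i : ℕ) : F.rank i ≤ F'.rank i := by
  obtain ⟨φ, ψ, h, e, -, -, hh, -, he⟩ := hF.exists_comparison F' i
  refine le_of_matrix_mul_eq_one (A := matrixModVars ψ) (B := matrixModVars φ) ?_
  have : ψ ∘ₗ φ = LinearMap.id + F.d i ∘ₗ h + e := LinearMap.ext hh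
  rw [← matrixModVars_comp, this, matrixModVars_add, matrixModVars_add, matrixModVars_id,
    matrixModVars_comp, hF.matrixModVars_d, he, Matrix.zero_mul, add_zero, add_zero]

/-- The ranks of a minimal graded free resolution do not depend on the resolution. -/
theorem IsMinimal.rank_eq {F F' : GradedFreeResolution I} (hF : F.IsMinimal) (hF' : F'.IsMinimal)
    (i : ℕ) : F.rank i = F'.rank i :=
  (hF.rank_le F' i).antisymm (hF'.rank_le F i)

end GradedFreeResolution

/-- A resolution of the ideal `I` by free modules, `⋯ → R ^ rank 1 → R ^ rank 0 → I → 0`, with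
generators in degree `t` and linear differentials. -/
structure LinearChain (I : Ideal (MvPolynomial V K)) (t : ℤ) where
  rank : ℕ → ℕ
  gen : (Fin (rank 0) → MvPolynomial V K) →ₗ[MvPolynomial V K] MvPolynomial V K
  d : (i : ℕ) → (Fin (rank (i + 1)) → MvPolynomial V K) →ₗ[MvPolynomial V K]
    (Fin (rank i) → MvPolynomial V K)
  range_gen : LinearMap.range gen = I
  exact_gen : Function.Exact (d 0) gen
  exact : ∀ i, Function.Exact (d (i + 1)) (d i)
  gen_homog : ∀ l, IsHomog (gen (Pi.single l 1)) t
  d_homog : ∀ i k l, (d i (Pi.single l 1) k).IsHomogeneous 1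

lemma IsHomog.isHomogeneous {p : MvPolynomial V K} {j : ℕ} (hp : IsHomog p j) :
    p.IsHomogeneous j := by
  intro c hc
  have := hp c (mem_support_iff.2 hc)
  rw [Finsupp.degree_eq_weight_one] at this
  exact_mod_cast this

/-- The comparison argument again, against the presentation of `R/I` by one generator. -/
lemma GradedFreeResolution.IsMinimal.rank_zero_le {I : Ideal (MvPolynomial V K)}
    {F : GradedFreeResolution I} (hF : F.IsMinimal) : F.rank 0 ≤ 1 := by
  let q : (Fin 1 → MvPolynomial V K) →ₗ[MvPolynomial V K] (MvPolynomial V K ⧸ I) :=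
    I.mkQ ∘ₗ LinearMap.proj 0
  have hq : Function.Surjective q :=
    I.mkQ_surjective.comp fun x => ⟨fun _ => x, rfl⟩
  obtain ⟨φ, hφ⟩ := exists_lift F.aug q fun x => hq _
  obtain ⟨ψ, hψ⟩ := exists_lift q F.aug fun x => F.aug_surjective _
  obtain ⟨h, hh⟩ := exists_lift (ψ ∘ₗ φ - LinearMap.id) (F.d 0) fun x =>
    (F.exact_aug _).1 (by simp [hφ, hψ])
  refine le_of_matrix_mul_eq_one (A := matrixModVars ψ) (B := matrixModVars φ) ?_
  have : ψ ∘ₗ φ = LinearMap.id + F.d 0 ∘ₗ h := by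
    refine LinearMap.ext fun x => ?_
    simp [hh]
  rw [← matrixModVars_comp, this, matrixModVars_add, matrixModVars_id, matrixModVars_comp,
    hF.matrixModVars_d, Matrix.zero_mul, add_zero]

/-- A minimal graded free resolution of `R/I` that is linear restricts to a resolution of `I`. -/
theorem GradedFreeResolution.IsMinimal.exists_linearChain {I : Ideal (MvPolynomial V K)}
    (hI : ∀ p ∈ I, constantCoeff p = 0) {F : GradedFreeResolution I} (hF : F.IsMinimal) {t : ℤ}
    (ht : ∀ i, 1 ≤ i → ∀ k : Fin (F.rank i), F.shift i k = t + i - 1) :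
    ∃ C : LinearChain I t, ∀ i, C.rank i = F.rank (i + 1) := by
  obtain ⟨ψ, hψ⟩ := exists_lift F.aug I.mkQ fun x => I.mkQ_surjective _
  have hmem : ∀ y, y ∈ I ↔ I.mkQ y = 0 := fun y => (Submodule.Quotient.mk_eq_zero I).symm
  obtain ⟨x, hx⟩ := F.aug_surjective (I.mkQ 1)
  have hx1 : constantCoeff (ψ x) = 1 := by
    have h1 : ψ x - 1 ∈ I := by
      rw [hmem, map_sub, hψ, hx, sub_self]
    have h2 := hI _ h1
    rwa [map_sub, map_one, sub_eq_zero] at h2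
  have hsub : Subsingleton (Fin (F.rank 0)) := Fin.subsingleton_iff_le_one.2 hF.rank_zero_le
  obtain ⟨k⟩ : Nonempty (Fin (F.rank 0)) := by
    by_contra h
    rw [not_nonempty_iff] at h
    rw [Subsingleton.elim x 0, map_zero, map_zero] at hx1
    exact zero_ne_one hx1
  have hsingle : ∀ y : Fin (F.rank 0) → MvPolynomial V K, y = y k • Pi.single k 1 := by
    intro y
    ext1 j
    rw [Subsingleton.elim j k]
    simp
  obtain ⟨p, hp, hpk⟩ := F.aug_homogeneous k
  -- Some multiple of the class of `p` is the class of `1`, and elements of `I` have no constant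
  -- term. Being homogeneous, `p` is then a nonzero constant and the generator has degree `0`.
  have hconst : constantCoeff p ≠ 0 := by
    intro h0
    have h1 : ψ (Pi.single k 1) - p ∈ I := by
      rw [hmem, map_sub, hψ, hpk, sub_eq_zero]
      rfl
    have h2 := hI _ h1
    rw [map_sub, h0, sub_zero] at h2
    rw [hsingle x, map_smul, smul_eq_mul, map_mul, h2, mul_zero] at hx1
    exact zero_ne_one hx1
  have hs0 : F.shift 0 k = 0 := by
    have := hp 0 (mem_support_iff.2 hconst)
    simpa using this.symm
  have hpC : p = C (constantCoeff p) := by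
    classical
    ext c
    rw [coeff_C]
    split_ifs with hc
    · rw [← hc]
      rfl
    · by_contra h
      have h1 := hp c (mem_support_iff.2 h)
      rw [hs0] at h1
      exact hc ((Finsupp.degree_eq_zero_iff c).1 (by exact_mod_cast h1)).symm
  set a := constantCoeff p with ha
  have haug : ∀ y, F.aug y = I.mkQ (y k * C a) := by
    intro y
    rw [hsingle y, map_smul, hpk, hpC, ← smul_eq_mul, map_smul]
    simp
  -- The augmentation is multiplication by the unit `a` followed by the quotient map, so scaling the
  -- first differential by `a` makes its image exactly `I`.
  let g : (Fin (F.rank 1) → MvPolynomial V K) →ₗ[MvPolynomial V K] MvPolynomial V K :=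
    (LinearMap.mulRight (MvPolynomial V K) (C a)) ∘ₗ LinearMap.proj k ∘ₗ F.d 0
  have hg : ∀ y, g y = F.d 0 y k * C a := fun y => rfl
  have hCa : (C a : MvPolynomial V K) ≠ 0 := by
    rw [Ne, C_eq_zero]
    exact hconst
  refine ⟨⟨fun i => F.rank (i + 1), g, fun i => F.d (i + 1), ?_, ?_, fun i => F.exact (i + 1),
    ?_, ?_⟩, fun i => rfl⟩
  · ext y
    rw [LinearMap.mem_range]
    constructor
    · rintro ⟨z, rfl⟩
      rw [hmem, hg, ← haug]
      exact F.exact_aug.apply_apply_eq_zero z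
    · intro hy
      obtain ⟨z, hz⟩ := (F.exact_aug (Pi.single k (y * C a⁻¹))).1 (by
        rw [haug, Pi.single_eq_same, mul_assoc, ← C_mul, inv_mul_cancel₀ hconst, C_1, mul_one]
        rwa [← hmem])
      refine ⟨z, ?_⟩
      rw [hg, hz, Pi.single_eq_same, mul_assoc, ← C_mul, inv_mul_cancel₀ hconst, C_1, mul_one]
  · intro y
    rw [← F.exact 0 y, hg, mul_eq_zero, or_iff_left hCa]
    constructor
    · intro h
      rw [hsingle (F.d 0 y), h, zero_smul]
    · intro h
      rw [h]
      rfl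
  · intro l c hc
    rw [hg, mul_comm] at hc
    have h1 := F.d_homogeneous 0 k l c (by
      rw [mem_support_iff, coeff_C_mul] at hc
      exact mem_support_iff.2 (right_ne_zero_of_mul hc))
    rw [h1, hs0, ht 1 le_rfl]
    push_cast
    ring
  · intro i k l
    have h1 := F.d_homogeneous (i + 1) k l
    rw [ht _ (by omega), ht _ (by omega)] at h1
    refine IsHomog.isHomogeneous ?_
    convert h1 using 1
    push_cast
    ring

end Comparison

/-! ### Linear first syzygies force linear linkage of the generators -/

section Linked

open MvPolynomial Finset

variable {V K : Type*} [Field K]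

lemma homogeneousComponent_mul_of_isHomogeneous {g : MvPolynomial V K} {n : ℕ}
    (hg : g.IsHomogeneous n) (s : ℕ) (p : MvPolynomial V K) :
    homogeneousComponent (s + n) (p * g) = homogeneousComponent s p * g := by
  induction p using MvPolynomial.induction_on' with
  | monomial c a =>
    have hc : (monomial c a).IsHomogeneous c.degree := isHomogeneous_monomial a rfl
    rw [homogeneousComponent_of_mem (hc.mul hg), homogeneousComponent_of_mem hc]
    by_cases h : s = c.degree
    · rw [if_pos h, if_pos (by rw [h])]
    · rw [if_neg h, if_neg (by omega), zero_mul]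
  | add p q hp hq => rw [add_mul, map_add, hp, hq, map_add, add_mul]

lemma homogeneousComponent_mul_of_lt {g : MvPolynomial V K} {n : ℕ}
    (hg : g.IsHomogeneous n) {j : ℕ} (hj : j < n) (p : MvPolynomial V K) :
    homogeneousComponent j (p * g) = 0 := by
  induction p using MvPolynomial.induction_on' with
  | monomial c a =>
    have hc : (monomial c a).IsHomogeneous c.degree := isHomogeneous_monomial a rfl
    rw [homogeneousComponent_of_mem (hc.mul hg), if_neg (by omega)]
  | add p q hp hq => rw [add_mul, map_add, hp, hq, add_zero]

lemma map_eq_sum_mul {r : ℕ}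
    (f : (Fin r → MvPolynomial V K) →ₗ[MvPolynomial V K] MvPolynomial V K)
    (h : Fin r → MvPolynomial V K) : f h = ∑ k, h k * f (Pi.single k 1) := by
  have := (Pi.basisFun (MvPolynomial V K) (Fin r)).sum_repr h
  conv_lhs => rw [← this]
  simp

lemma homogeneousComponent_map {r n : ℕ}
    {f : (Fin r → MvPolynomial V K) →ₗ[MvPolynomial V K] MvPolynomial V K}
    (hf : ∀ k, (f (Pi.single k 1)).IsHomogeneous n) (s : ℕ) (h : Fin r → MvPolynomial V K) :
    homogeneousComponent (s + n) (f h) = f fun k => homogeneousComponent s (h k) := by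
  rw [map_eq_sum_mul, map_eq_sum_mul, map_sum]
  exact sum_congr rfl fun k _ => homogeneousComponent_mul_of_isHomogeneous (hf k) s (h k)

lemma homogeneousComponent_map_of_lt {r n : ℕ}
    {f : (Fin r → MvPolynomial V K) →ₗ[MvPolynomial V K] MvPolynomial V K}
    (hf : ∀ k, (f (Pi.single k 1)).IsHomogeneous n) {j : ℕ} (hj : j < n)
    (h : Fin r → MvPolynomial V K) : homogeneousComponent j (f h) = 0 := by
  rw [map_eq_sum_mul, map_sum]
  exact sum_eq_zero fun k _ => homogeneousComponent_mul_of_lt (hf k) hj (h k)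

lemma isHomogeneous_map {r n s : ℕ}
    {f : (Fin r → MvPolynomial V K) →ₗ[MvPolynomial V K] MvPolynomial V K}
    (hf : ∀ k, (f (Pi.single k 1)).IsHomogeneous n) {h : Fin r → MvPolynomial V K}
    (hh : ∀ k, (h k).IsHomogeneous s) : (f h).IsHomogeneous (s + n) := by
  rw [map_eq_sum_mul]
  exact IsHomogeneous.sum _ _ _ fun k _ => (hh k).mul (hf k)

/-- The ideal generated by the squarefree monomials with supports in `S`. -/
noncomputable def sqfreeIdeal (K : Type*) [Field K] (S : Finset (Finset V)) :
    Ideal (MvPolynomial V K) :=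
  Ideal.span ((fun s => monomial s (1 : K)) '' (sqfreeExp '' (S : Set (Finset V))))

lemma mem_sqfreeIdeal {S : Finset (Finset V)} {p : MvPolynomial V K} :
    p ∈ sqfreeIdeal K S ↔ ∀ c ∈ p.support, ∃ F ∈ S, F ⊆ c.support := by
  classical
  rw [sqfreeIdeal, mem_ideal_span_monomial_image]
  refine forall₂_congr fun c _ => ?_
  constructor
  · rintro ⟨_, ⟨F, hF, rfl⟩, h⟩
    exact ⟨F, hF, sqfreeExp_le_iff.1 h⟩
  · rintro ⟨F, hF, h⟩
    exact ⟨_, ⟨F, hF, rfl⟩, sqfreeExp_le_iff.2 h⟩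

lemma monomial_mem_sqfreeIdeal {S : Finset (Finset V)} {F : Finset V} (hF : F ∈ S) :
    monomial (sqfreeExp F) (1 : K) ∈ sqfreeIdeal K S :=
  Ideal.subset_span ⟨_, ⟨F, hF, rfl⟩, rfl⟩

lemma eq_of_le_of_degree_le {c e : V →₀ ℕ} (h : c ≤ e) (hd : e.degree ≤ c.degree) : c = e := by
  have h1 : (e - c).degree + c.degree = e.degree := by rw [← map_add, tsub_add_cancel_of_le h]
  have h2 : e - c = 0 := (Finsupp.degree_eq_zero_iff _).1 (by omega)
  rw [← tsub_add_cancel_of_le h, h2, zero_add]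

lemma degree_mono {c e : V →₀ ℕ} (h : c ≤ e) : c.degree ≤ e.degree := by
  have h1 : (e - c).degree + c.degree = e.degree := by rw [← map_add, tsub_add_cancel_of_le h]
  omega

namespace LinearChain

variable {S : Finset (Finset V)}

lemma gen_mem {I : Ideal (MvPolynomial V K)} {t : ℤ} (C : LinearChain I t)
    (h : Fin (C.rank 0) → MvPolynomial V K) : C.gen h ∈ I := by
  have := LinearMap.mem_range_self C.gen h
  rwa [C.range_gen] at this

/-- Generators of an antichain ideal with a linear resolution all have the same degree. -/
lemma card_eq {t : ℤ} (C : LinearChain (sqfreeIdeal K S) t)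
    (hS : ∀ F ∈ S, ∀ H ∈ S, H ⊆ F → H = F) {F : Finset V} (hF : F ∈ S) : (#F : ℤ) = t := by
  classical
  obtain ⟨h, hh⟩ : ∃ h, C.gen h = monomial (sqfreeExp F) 1 := by
    rw [← LinearMap.mem_range, C.range_gen]
    exact monomial_mem_sqfreeIdeal hF
  have h1 : coeff (sqfreeExp F) (C.gen h) ≠ 0 := by
    rw [hh, coeff_monomial, if_pos rfl]
    exact one_ne_zero
  rw [map_eq_sum_mul, coeff_sum] at h1
  obtain ⟨k, -, hk⟩ := exists_ne_zero_of_sum_ne_zero h1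
  rw [coeff_mul] at hk
  obtain ⟨⟨p, q⟩, hpq, hne⟩ := exists_ne_zero_of_sum_ne_zero hk
  rw [HasAntidiagonal.mem_antidiagonal] at hpq
  have hq : q ∈ (C.gen (Pi.single k 1)).support := mem_support_iff.2 (right_ne_zero_of_mul hne)
  -- The exponent `q` of a degree-`t` generator divides the monomial of `F` and is divisible by that
  -- of some `H`; the antichain condition forces `H = F`, so `q` is the exponent of `F`.
  obtain ⟨H, hH, hHq⟩ := mem_sqfreeIdeal.1 (C.gen_mem (Pi.single k 1)) q hq
  have hqF : q ≤ sqfreeExp F := hpq ▸ le_add_self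
  have hHF := hS F hF H hH (by
    rw [← support_sqfreeExp F]
    exact hHq.trans (Finsupp.support_mono hqF))
  rw [hHF, ← sqfreeExp_le_iff] at hHq
  rw [← C.gen_homog k q hq, le_antisymm hqF hHq, degree_sqfreeExp]

variable {t : ℕ} (C : LinearChain (sqfreeIdeal K S) t)

lemma gen_isHomogeneous (k : Fin (C.rank 0)) : (C.gen (Pi.single k 1)).IsHomogeneous t :=
  (C.gen_homog k).isHomogeneous

/-- The map from the first free module to the free module on `S` induced by expressing the
generators in terms of the monomials. -/
noncomputable def coord (X : Finset V) :
    (Fin (C.rank 0) → MvPolynomial V K) →ₗ[MvPolynomial V K] MvPolynomial V K :=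
  ∑ k : Fin (C.rank 0), MvPolynomial.C (σ := V) (coeff (sqfreeExp X) (C.gen (Pi.single k 1))) •
    (LinearMap.proj k : (Fin (C.rank 0) → MvPolynomial V K) →ₗ[MvPolynomial V K] MvPolynomial V K)

lemma coord_apply (X : Finset V) (h : Fin (C.rank 0) → MvPolynomial V K) :
    C.coord X h = ∑ k, MvPolynomial.C (coeff (sqfreeExp X) (C.gen (Pi.single k 1))) * h k := by
  simp [coord]

/-- All the monomials of `S` have degree `t`, so they span the degree-`t` part of the ideal over
`K`. -/
lemma gen_single_eq (hS : ∀ F ∈ S, #F = t) (k : Fin (C.rank 0)) :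
    C.gen (Pi.single k 1) = ∑ X ∈ S,
      MvPolynomial.C (coeff (sqfreeExp X) (C.gen (Pi.single k 1))) * monomial (sqfreeExp X) 1 := by
  classical
  ext c
  rw [coeff_sum]
  simp only [coeff_C_mul, coeff_monomial, mul_ite, mul_one, mul_zero]
  by_cases hc : coeff c (C.gen (Pi.single k 1)) = 0
  · rw [hc, sum_eq_zero]
    intro X _
    split_ifs with h
    · rw [h, hc]
    · rfl
  · obtain ⟨X, hX, hXc⟩ := mem_sqfreeIdeal.1 (C.gen_mem (Pi.single k 1)) c (mem_support_iff.2 hc)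
    have hdeg : c.degree = t := by
      have := C.gen_homog k c (mem_support_iff.2 hc)
      exact_mod_cast this
    have hXe : sqfreeExp X = c := eq_of_le_of_degree_le (sqfreeExp_le_iff.2 hXc)
      (by rw [degree_sqfreeExp, hS X hX, hdeg])
    rw [sum_eq_single_of_mem X hX, if_pos hXe, hXe]
    intro Y _ hY
    exact if_neg fun h => hY (sqfreeExp_injective (h.trans hXe.symm))

lemma gen_eq_sum_coord (hS : ∀ F ∈ S, #F = t) (h : Fin (C.rank 0) → MvPolynomial V K) :
    C.gen h = ∑ X ∈ S, C.coord X h * monomial (sqfreeExp X) 1 := by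
  simp only [coord_apply, sum_mul]
  rw [sum_comm, map_eq_sum_mul]
  refine sum_congr rfl fun k _ => ?_
  rw [C.gen_single_eq hS k, mul_sum]
  refine sum_congr rfl fun X _ => ?_
  rw [← C.gen_single_eq hS k]
  ring

/-- The basis of the chain need not map to monomials. The constant terms of any preimage of the
monomial of `F` form a preimage too, and their coordinates are read off from coefficients in degree
`t`. -/
lemma exists_coord_eq [DecidableEq V] {F : Finset V} (hF : F ∈ S) (hFt : #F = t) :
    ∃ α : Fin (C.rank 0) → MvPolynomial V K, C.gen α = monomial (sqfreeExp F) 1 ∧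
      ∀ X, C.coord X α = if X = F then 1 else 0 := by
  obtain ⟨h, hh⟩ : ∃ h, C.gen h = monomial (sqfreeExp F) 1 := by
    rw [← LinearMap.mem_range, C.range_gen]
    exact monomial_mem_sqfreeIdeal hF
  have hα : C.gen (fun k => MvPolynomial.C (coeff 0 (h k))) = monomial (sqfreeExp F) 1 := by
    have h1 := homogeneousComponent_map C.gen_isHomogeneous 0 h
    simp only [homogeneousComponent_zero] at h1
    rw [← h1, hh, zero_add, homogeneousComponent_of_mem
      (isHomogeneous_monomial 1 (degree_sqfreeExp F)), if_pos hFt.symm]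
  refine ⟨_, hα, fun X => ?_⟩
  have h2 : coeff (sqfreeExp X) (monomial (sqfreeExp F) (1 : K)) =
      ∑ k, coeff 0 (h k) * coeff (sqfreeExp X) (C.gen (Pi.single k 1)) := by
    rw [← hα, map_eq_sum_mul, coeff_sum]
    simp only [coeff_C_mul]
  rw [coord_apply]
  simp only [← MvPolynomial.C_mul]
  rw [← map_sum]
  simp only [mul_comm (coeff (sqfreeExp X) _)]
  rw [← h2, coeff_monomial]
  by_cases hX : X = F
  · rw [if_pos hX, if_pos (by rw [hX]), MvPolynomial.C_1]
  · rw [if_neg hX, if_neg fun h => hX (sqfreeExp_injective h).symm, MvPolynomial.C_0]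

lemma exists_of_coeff_mul_sqfree_ne_zero {p : MvPolynomial V K} {n : ℕ} (hp : p.IsHomogeneous n)
    {X : Finset V} {q : V →₀ ℕ} (h : coeff q (p * monomial (sqfreeExp X) 1) ≠ 0) :
    X ⊆ q.support ∧ q.degree = n + #X := by
  classical
  have h1 : sqfreeExp X ≤ q := by
    by_contra hle
    rw [coeff_mul_monomial', if_neg hle] at h
    exact h rfl
  refine ⟨sqfreeExp_le_iff.1 h1, ?_⟩
  by_contra h2
  exact h ((hp.mul (isHomogeneous_monomial 1 (degree_sqfreeExp X))).coeff_eq_zero h2)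

/-- The functional that sums the coefficients of the squarefree monomial of `U` over a set `A` of
generators that is closed under linear linkage inside `U` vanishes on the boundaries. -/
lemma sum_coeff_coord_d_eq_zero [DecidableEq V] (hS : ∀ F ∈ S, #F = t) {A : Finset (Finset V)}
    (hAS : A ⊆ S) {U : Finset V}
    (hA : ∀ X ∈ A, ∀ Y ∈ S, X ⊆ U → Y ⊆ U → #(X ∪ Y) ≤ t + 1 → Y ∈ A)
    (w : Fin (C.rank 1) → MvPolynomial V K) :
    ∑ X ∈ A, coeff (sqfreeExp U) (C.coord X (C.d 0 w) * monomial (sqfreeExp X) 1) = 0 := by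
  have hlin : ∀ X l, (C.coord X (C.d 0 (Pi.single l 1))).IsHomogeneous 1 := by
    intro X l
    rw [coord_apply]
    exact IsHomogeneous.sum _ _ _ fun k _ => (C.d_homog 0 k l).C_mul _
  -- A linear column only involves exponents `q` of degree `t + 1`. Any two members dividing such a
  -- `q` have a union of size at most `t + 1`, so once one is in `A` all are; the sum over `A` is
  -- then the sum over `S`, a coefficient of `gen ∘ d = 0`.
  have hq : ∀ q ≤ sqfreeExp U, ∀ l, ∑ X ∈ A,
      coeff q (C.coord X (C.d 0 (Pi.single l 1)) * monomial (sqfreeExp X) 1) = 0 := by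
    intro q hqU l
    by_contra hne
    obtain ⟨X, hX, hXne⟩ := exists_ne_zero_of_sum_ne_zero hne
    obtain ⟨hXq, hdeg⟩ := exists_of_coeff_mul_sqfree_ne_zero (hlin X l) hXne
    have hqU' : q.support ⊆ U := by
      rw [← support_sqfreeExp U]
      exact Finsupp.support_mono hqU
    apply hne
    rw [sum_subset hAS, ← coeff_sum, ← C.gen_eq_sum_coord hS,
      C.exact_gen.apply_apply_eq_zero, coeff_zero]
    intro Y hY hYA
    by_contra hYne
    obtain ⟨hYq, -⟩ := exists_of_coeff_mul_sqfree_ne_zero (hlin Y l) hYne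
    refine hYA (hA X hX Y hY (hXq.trans hqU') (hYq.trans hqU') ?_)
    have := degree_mono (sqfreeExp_le_iff.2 (union_subset hXq hYq))
    rw [degree_sqfreeExp, hdeg, hS X (hAS hX)] at this
    omega
  have hexp : ∀ X, C.coord X (C.d 0 w) * monomial (sqfreeExp X) 1 =
      ∑ l, w l * (C.coord X (C.d 0 (Pi.single l 1)) * monomial (sqfreeExp X) 1) := by
    intro X
    rw [← LinearMap.comp_apply, map_eq_sum_mul, sum_mul]
    exact sum_congr rfl fun l _ => mul_assoc _ _ _
  simp only [hexp, coeff_sum]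
  rw [sum_comm]
  refine sum_eq_zero fun l _ => ?_
  simp only [coeff_mul (w l)]
  rw [sum_comm]
  refine sum_eq_zero fun pq hpq => ?_
  rw [← mul_sum, hq _ _ l, mul_zero]
  rw [HasAntidiagonal.mem_antidiagonal] at hpq
  exact hpq ▸ le_add_self

/-- If `H` is not in the linkage component `A` of `F` inside `F ∪ H`, the functional of `A` takes
the value `1` on the syzygy between the two monomials coming from their least common multiple. But
that syzygy is a boundary, where the functional vanishes. -/
theorem linearlyLinked [DecidableEq V] (C : LinearChain (sqfreeIdeal K S) t) (hS : ∀ F ∈ S, #F = t) : LinearlyLinked S t := by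
  classical
  intro F hF H hH
  set r : Finset V → Finset V → Prop :=
    fun A B => A ∈ S ∧ B ∈ S ∧ A ⊆ F ∪ H ∧ B ⊆ F ∪ H ∧ #(A ∪ B) ≤ t + 1 with hr
  by_contra hFH
  set A : Finset (Finset V) := {X ∈ S | Relation.ReflTransGen r F X} with hAdef
  have hFA : F ∈ A := mem_filter.2 ⟨hF, .refl⟩
  have hHA : H ∉ A := fun h => hFH (mem_filter.1 h).2
  obtain ⟨α, hα, hα'⟩ := C.exists_coord_eq hF (hS F hF)
  obtain ⟨β, hβ, hβ'⟩ := C.exists_coord_eq hH (hS H hH)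
  obtain ⟨w, hw⟩ := (C.exact_gen (monomial (sqfreeExp (H \ F)) (1 : K) • α -
      monomial (sqfreeExp (F \ H)) (1 : K) • β)).1 (by
    rw [map_sub, map_smul, map_smul, hα, hβ, smul_eq_mul, smul_eq_mul, monomial_mul, monomial_mul,
      sqfreeExp_add_sdiff, sqfreeExp_add_sdiff, union_comm, sub_self])
  have h0 := C.sum_coeff_coord_d_eq_zero hS (filter_subset _ S : A ⊆ S) (U := F ∪ H)
    (fun X hX Y hY hXU hYU hle => mem_filter.2 ⟨hY, (mem_filter.1 hX).2.tail
      ⟨(mem_filter.1 hX).1, hY, hXU, hYU, hle⟩⟩) w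
  rw [hw, sum_eq_single_of_mem F hFA] at h0
  · have hne : F ≠ H := fun h => hHA (h ▸ hFA)
    rw [map_sub, map_smul, map_smul, hα', hβ', if_pos rfl, if_neg hne, smul_zero, sub_zero,
      smul_eq_mul, mul_one, monomial_mul, sqfreeExp_add_sdiff, coeff_monomial, if_pos rfl,
      mul_one] at h0
    exact one_ne_zero h0
  · intro X hX hXF
    have hne : X ≠ H := fun h => hHA (h ▸ hX)
    rw [map_sub, map_smul, map_smul, hα', hβ', if_neg hXF, if_neg hne, smul_zero, smul_zero,
      sub_zero, zero_mul, coeff_zero]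

end LinearChain

end Linked

/-! ### Ranks of a linear resolution from the Hilbert series -/

section Hilbert

open MvPolynomial Finset

variable {V K : Type*} [Field K]

lemma finrank_map_add_finrank_inf_ker {M N : Type*} [AddCommGroup M] [Module K M] [AddCommGroup N]
    [Module K N] (f : M →ₗ[K] N) (W : Submodule K M) [FiniteDimensional K W] :
    Module.finrank K (W.map f) + Module.finrank K ↥(W ⊓ LinearMap.ker f) = Module.finrank K W := by
  have h := LinearMap.finrank_range_add_finrank_ker (f.domRestrict W)
  rw [LinearMap.range_domRestrict, LinearMap.ker_domRestrict] at h
  rw [← h, ← Submodule.map_comap_subtype, Submodule.finrank_map_subtype_eq]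

lemma finrank_restrictSupport (T : Finset (V →₀ ℕ)) :
    Module.finrank K (restrictSupport K (T : Set (V →₀ ℕ))) = #T := by
  rw [Module.finrank_eq_card_basis (basisRestrictSupport K (T : Set (V →₀ ℕ)))]
  simp

lemma finiteDimensional_restrictSupport (T : Finset (V →₀ ℕ)) :
    FiniteDimensional K (restrictSupport K (T : Set (V →₀ ℕ))) :=
  (basisRestrictSupport K (T : Set (V →₀ ℕ))).finiteDimensional_of_finite

lemma isHomogeneous_iff_mem_support {p : MvPolynomial V K} {s : ℕ} :
    p.IsHomogeneous s ↔ ∀ c ∈ p.support, c.degree = s := by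
  constructor
  · intro h c hc
    rw [Finsupp.degree_eq_weight_one]
    exact h (mem_support_iff.1 hc)
  · intro h c hc
    have := h c (mem_support_iff.2 hc)
    rwa [Finsupp.degree_eq_weight_one] at this

lemma homogeneousSubmodule_eq_restrictSupport [Fintype V] [DecidableEq V] (s : ℕ) :
    homogeneousSubmodule V K s =
      restrictSupport K (((univ : Finset V).finsuppAntidiag s : Finset (V →₀ ℕ)) : Set _) := by
  ext p
  rw [mem_homogeneousSubmodule, isHomogeneous_iff_mem_support, mem_restrictSupport_iff]
  refine forall₂_congr fun c _ => ?_
  simp [Finsupp.degree_eq_sum]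

/-- The vectors of polynomials with all entries homogeneous of degree `s`. -/
noncomputable def homogVec (V K : Type*) [Field K] (r s : ℕ) :
    Submodule K (Fin r → MvPolynomial V K) :=
  Submodule.pi Set.univ fun _ => homogeneousSubmodule V K s

lemma mem_homogVec {r s : ℕ} {x : Fin r → MvPolynomial V K} :
    x ∈ homogVec V K r s ↔ ∀ k, (x k).IsHomogeneous s := by
  simp [homogVec, Submodule.mem_pi]

/-- Vectors of homogeneous polynomials, as a product. -/
noncomputable def homogVecEquiv (r s : ℕ) :
    homogVec V K r s ≃ₗ[K] (Fin r → homogeneousSubmodule V K s) where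
  toFun x k := ⟨x.1 k, mem_homogVec.1 x.2 k⟩
  invFun y := ⟨fun k => y k, mem_homogVec.2 fun k => (y k).2⟩
  map_add' _ _ := rfl
  map_smul' _ _ := rfl
  left_inv _ := rfl
  right_inv _ := rfl

lemma finiteDimensional_homogVec [Fintype V] (r s : ℕ) :
    FiniteDimensional K (homogVec V K r s) := by
  classical
  have : FiniteDimensional K (homogeneousSubmodule V K s) := by
    rw [homogeneousSubmodule_eq_restrictSupport]
    exact finiteDimensional_restrictSupport _
  exact (homogVecEquiv r s).symm.finiteDimensional

lemma finrank_homogVec [Fintype V] [DecidableEq V] (r s : ℕ) :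
    Module.finrank K (homogVec V K r s) = r * #((univ : Finset V).finsuppAntidiag s) := by
  have : FiniteDimensional K (homogeneousSubmodule V K s) := by
    rw [homogeneousSubmodule_eq_restrictSupport]
    exact finiteDimensional_restrictSupport _
  rw [(homogVecEquiv r s).finrank_eq, Module.finrank_pi_fintype, sum_const, card_univ,
    Fintype.card_fin, smul_eq_mul, homogeneousSubmodule_eq_restrictSupport,
    finrank_restrictSupport]

section Exact

variable {r r' : ℕ} {M : Type*} [AddCommGroup M] [Module K M] [Module (MvPolynomial V K) M]
  [IsScalarTower K (MvPolynomial V K) M]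
  {g : (Fin r' → MvPolynomial V K) →ₗ[MvPolynomial V K] (Fin r → MvPolynomial V K)}
  {f : (Fin r → MvPolynomial V K) →ₗ[MvPolynomial V K] M}

lemma homogVec_zero_inf_ker (hgf : Function.Exact g f)
    (hg : ∀ k l, (g (Pi.single l 1) k).IsHomogeneous 1) :
    homogVec V K r 0 ⊓ LinearMap.ker (f.restrictScalars K) = ⊥ := by
  rw [eq_bot_iff]
  rintro x ⟨hx, hxf⟩
  obtain ⟨w, rfl⟩ := (hgf x).1 hxf
  rw [Submodule.mem_bot]
  ext1 k
  have h1 := homogeneousComponent_map_of_lt (f := LinearMap.proj k ∘ₗ g) (hg k) zero_lt_one w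
  rwa [LinearMap.comp_apply, LinearMap.proj_apply,
    homogeneousComponent_eq_self (mem_homogVec.1 hx k)] at h1

/-- Since `g` has linear entries, taking the degree-`s` component of a preimage recovers a
homogeneous element of degree `s + 1`. -/
lemma homogVec_succ_inf_ker (hgf : Function.Exact g f)
    (hg : ∀ k l, (g (Pi.single l 1) k).IsHomogeneous 1) (s : ℕ) :
    homogVec V K r (s + 1) ⊓ LinearMap.ker (f.restrictScalars K) =
      (homogVec V K r' s).map (g.restrictScalars K) := by
  ext x
  rw [Submodule.mem_map]
  constructor
  · rintro ⟨hx, hxf⟩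
    obtain ⟨w, rfl⟩ := (hgf x).1 hxf
    refine ⟨fun k => homogeneousComponent s (w k),
      mem_homogVec.2 fun k => homogeneousComponent_isHomogeneous _ _, ?_⟩
    ext1 k
    have h1 := homogeneousComponent_map (f := LinearMap.proj k ∘ₗ g) (hg k) s w
    rw [LinearMap.comp_apply, LinearMap.proj_apply,
      homogeneousComponent_eq_self (mem_homogVec.1 hx k)] at h1
    exact h1.symm
  · rintro ⟨w, hw, rfl⟩
    refine ⟨mem_homogVec.2 fun k => ?_, hgf.apply_apply_eq_zero w⟩
    exact isHomogeneous_map (f := LinearMap.proj k ∘ₗ g) (hg k) (mem_homogVec.1 hw)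

variable [Fintype V]

/-- The rank of a map of free modules on the vectors of degree `s`, as a power series in `s`. -/
noncomputable def rankSeries (f : (Fin r → MvPolynomial V K) →ₗ[MvPolynomial V K] M) :
    PowerSeries ℤ :=
  PowerSeries.mk fun s =>
    (Module.finrank K ((homogVec V K r s).map (f.restrictScalars K)) : ℤ)

/-- Rank-nullity in each degree: the kernel in degree `s` is the image of degree `s - 1` under `g`,
which accounts for the factor `X`. -/
lemma rankSeries_add (hgf : Function.Exact g f)
    (hg : ∀ k l, (g (Pi.single l 1) k).IsHomogeneous 1) :
    rankSeries f + PowerSeries.X * rankSeries g =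
      PowerSeries.C (r : ℤ) * polySeries (Fintype.card V) := by
  classical
  ext s
  have := finiteDimensional_homogVec (V := V) (K := K) r s
  have h := finrank_map_add_finrank_inf_ker (f.restrictScalars K) (homogVec V K r s)
  rw [finrank_homogVec] at h
  rw [map_add, PowerSeries.coeff_C_mul, ← card_univ (α := V), coeff_polySeries, ← Nat.cast_mul, ← h,
    rankSeries, PowerSeries.coeff_mk, Nat.cast_add]
  congr 1
  cases s with
  | zero =>
    rw [homogVec_zero_inf_ker hgf hg]
    simp
  | succ s =>
    rw [homogVec_succ_inf_ker hgf hg, PowerSeries.coeff_succ_X_mul, rankSeries,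
      PowerSeries.coeff_mk]

end Exact

namespace LinearChain

variable [Fintype V] [DecidableEq V] {S : Finset (Finset V)} {t : ℕ}

lemma rankSeries_gen (C : LinearChain (sqfreeIdeal K S) t) :
    rankSeries C.gen = idealSeries S t := by
  ext s
  rw [rankSeries, idealSeries, PowerSeries.coeff_mk, PowerSeries.coeff_mk,
    ← finrank_restrictSupport (K := K)]
  suffices h : (homogVec V K (C.rank 0) s).map (C.gen.restrictScalars K) =
      restrictSupport K (idealExps S (t + s) : Set (V →₀ ℕ)) by rw [h]
  ext p
  have hp : p ∈ restrictSupport K (idealExps S (t + s) : Set (V →₀ ℕ)) ↔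
      p.IsHomogeneous (s + t) ∧ p ∈ sqfreeIdeal K S := by
    rw [mem_restrictSupport_iff, isHomogeneous_iff_mem_support, mem_sqfreeIdeal, ← forall₂_and]
    refine forall₂_congr fun c _ => ?_
    rw [mem_coe, mem_idealExps, add_comm]
  rw [hp, Submodule.mem_map]
  constructor
  · rintro ⟨h, hh, rfl⟩
    exact ⟨isHomogeneous_map C.gen_isHomogeneous (mem_homogVec.1 hh), C.gen_mem h⟩
  · rintro ⟨hp1, hp2⟩
    rw [← C.range_gen] at hp2
    obtain ⟨h, rfl⟩ := hp2
    refine ⟨fun k => homogeneousComponent s (h k),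
      mem_homogVec.2 fun k => homogeneousComponent_isHomogeneous _ _, ?_⟩
    rw [LinearMap.restrictScalars_apply, ← homogeneousComponent_map C.gen_isHomogeneous,
      homogeneousComponent_eq_self hp1]

/-- The ranks in a linear resolution are determined by the Hilbert series of the ideal. -/
theorem rank_eq_coeff (C : LinearChain (sqfreeIdeal K S) t) {Q : PowerSeries ℤ}
    (hQ : idealSeries S t = polySeries (Fintype.card V) * Q) (i : ℕ) :
    (C.rank i : ℤ) = (-1) ^ i * PowerSeries.coeff i Q := by
  obtain ⟨u, hu⟩ := (isUnit_polySeries (Fintype.card V)).exists_left_inv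
  obtain ⟨q, hq0, hq⟩ : ∃ q : ℕ → PowerSeries ℤ, q 0 = Q ∧
      ∀ i, q i + PowerSeries.X * q (i + 1) = PowerSeries.C (C.rank i : ℤ) := by
    -- Dividing the rank series by `polySeries` turns the rank-nullity relations into a recursion
    -- with constant right-hand sides.
    refine ⟨fun i => i.casesOn (u * rankSeries C.gen) fun i => u * rankSeries (C.d i), ?_, ?_⟩
    · change u * rankSeries C.gen = Q
      rw [C.rankSeries_gen, hQ, ← mul_assoc, hu, one_mul]
    · intro i
      cases i with
      | zero =>
        have := rankSeries_add C.exact_gen (C.d_homog 0)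
        change u * rankSeries C.gen + PowerSeries.X * (u * rankSeries (C.d 0)) = _
        linear_combination u * this + PowerSeries.C (C.rank 0 : ℤ) * hu
      | succ i =>
        have := rankSeries_add (C.exact i) (C.d_homog (i + 1))
        linear_combination u * this + PowerSeries.C (C.rank (i + 1) : ℤ) * hu
  -- In positive degree the constant drops out, so each coefficient is minus the preceding one of
  -- the next series, down to a constant term, which is a rank.
  have key : ∀ s i, PowerSeries.coeff s (q i) = (-1) ^ s * (C.rank (i + s) : ℤ) := by
    intro s
    induction s with
    | zero =>
      intro i
      have := congrArg (PowerSeries.coeff 0) (hq i)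
      simpa using this
    | succ s ih =>
      intro i
      have := congrArg (PowerSeries.coeff (s + 1)) (hq i)
      rw [map_add, PowerSeries.coeff_succ_X_mul, ih, PowerSeries.coeff_C,
        if_neg (Nat.succ_ne_zero s), add_right_comm, add_assoc i s 1] at this
      rw [pow_succ]
      linear_combination this
  rw [← hq0, key i 0, ← mul_assoc, ← pow_add, Even.neg_one_pow ⟨i, rfl⟩, one_mul, zero_add]

end LinearChain

end Hilbert

/-! ### From complexes to finite families of sets -/

section Facets

open Finset

variable {V : Type*}

lemma exists_facet_superset [Finite V] {Δ : PreAbstractSimplicialComplex V} {G : Finset V}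
    (hG : G ∈ Δ) : ∃ F ∈ facets Δ, G ⊆ F := by
  obtain ⟨F, hGF, hF⟩ := (Set.toFinite {F | F ∈ Δ}).exists_le_maximal hG
  exact ⟨F, hF, hGF⟩

lemma mem_of_subset {Δ : PreAbstractSimplicialComplex V} {F G : Finset V} (hF : F ∈ Δ)
    (hGF : G ⊆ F) (hG : G.Nonempty) : G ∈ Δ :=
  (Δ.isRelLowerSet_faces hF).2 hGF hG

lemma nonempty_of_mem {Δ : PreAbstractSimplicialComplex V} {F : Finset V} (hF : F ∈ Δ) :
    F.Nonempty :=
  (Δ.isRelLowerSet_faces hF).1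

lemma eq_of_mem_facets {Δ : PreAbstractSimplicialComplex V} {F H : Finset V} (hF : F ∈ facets Δ)
    (hH : H ∈ facets Δ) (h : H ⊆ F) : H = F :=
  h.antisymm (hH.2 hF.1 h)

/-- Every set of facets is the set of facets of a complex. -/
lemma exists_facets_eq {Δ : PreAbstractSimplicialComplex V} {T : Set (Finset V)}
    (hT : T ⊆ facets Δ) : ∃ Γ : PreAbstractSimplicialComplex V, facets Γ = T := by
  refine ⟨⟨{G | G.Nonempty ∧ ∃ F ∈ T, G ⊆ F}, ?_⟩, ?_⟩
  · rintro G ⟨hG, F, hF, hGF⟩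
    exact ⟨hG, fun H hH hne => ⟨hne, F, hF, (show H ⊆ G from hH).trans hGF⟩⟩
  · ext F
    constructor
    · rintro ⟨⟨hF, H, hH, hFH⟩, hmax⟩
      rwa [hFH.antisymm (hmax (y := H) ⟨nonempty_of_mem (hT hH).1, H, hH, Subset.rfl⟩ hFH)]
    · intro hF
      refine ⟨⟨nonempty_of_mem (hT hF).1, F, hF, Subset.rfl⟩, ?_⟩
      rintro G ⟨_, H, hH, hGH⟩ hFG
      rwa [eq_of_mem_facets (hT hH) (hT hF) ((show F ⊆ G from hFG).trans hGH)]

lemma IsTree.hasLeaves [DecidableEq V] {Δ : PreAbstractSimplicialComplex V} (hΔ : IsTree Δ)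
    {S : Finset (Finset V)} (hS : (S : Set (Finset V)) = facets Δ) : HasLeaves S := by
  intro T hTS hne
  have hT : (T : Set (Finset V)) ⊆ facets Δ := hS ▸ coe_subset.2 hTS
  obtain ⟨Γ, hΓ⟩ := exists_facets_eq hT
  obtain ⟨F, hF, h⟩ := hΔ.2 Γ (hΓ ▸ hne) (hΓ ▸ hT)
  rw [hΓ] at hF h
  refine ⟨F, hF, h.imp (fun h => ?_) fun h => h⟩
  exact_mod_cast h

lemma facetIdeal_eq_sqfreeIdeal (K : Type*) [Field K] {Δ : PreAbstractSimplicialComplex V}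
    {S : Finset (Finset V)} (hS : (S : Set (Finset V)) = facets Δ) :
    facetIdeal K Δ = sqfreeIdeal K S := by
  have hprod : ∀ F : Finset V, ∏ v ∈ F, (MvPolynomial.X v : MvPolynomial V K) =
      MvPolynomial.monomial (sqfreeExp F) 1 := by
    intro F
    classical
    rw [MvPolynomial.monomial_eq, map_one, one_mul, Finsupp.prod, support_sqfreeExp]
    exact prod_congr rfl fun v hv => by rw [sqfreeExp_apply, if_pos hv, pow_one]
  rw [facetIdeal, sqfreeIdeal, Set.image_image, hS]
  congr 1
  ext f
  constructor
  · rintro ⟨F, hF, rfl⟩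
    exact ⟨F, hF, (hprod F).symm⟩
  · rintro ⟨F, hF, rfl⟩
    exact ⟨F, hF, (hprod F).symm⟩

lemma numFacetsContaining_eq [DecidableEq V] {Δ : PreAbstractSimplicialComplex V}
    {S : Finset (Finset V)} (hS : (S : Set (Finset V)) = facets Δ) (G : Finset V) :
    numFacetsContaining Δ G = #{F ∈ S | G ⊆ F} := by
  rw [numFacetsContaining, ← Set.ncard_coe_finset]
  congr 1
  ext F
  simp [← hS]

lemma mem_facesOfDim [Fintype V] {Δ : PreAbstractSimplicialComplex V} {G : Finset V} {k : ℤ} :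
    G ∈ facesOfDim Δ k ↔ IsFace Δ G ∧ faceDim G = k := by
  simp [facesOfDim]

/-- A `d`-element set that is not a face lies in no facet and contributes `Nat.choose 0 (i + 1) =
0`. For `d = 0` the only term is the empty face. -/
lemma sum_facesOfDim_eq_ridgeSum [Fintype V] [DecidableEq V] {Δ : PreAbstractSimplicialComplex V}
    {S : Finset (Finset V)} (hS : (S : Set (Finset V)) = facets Δ) (d i : ℕ) :
    ∑ G ∈ facesOfDim Δ ((d : ℤ) - 1), (numFacetsContaining Δ G).choose (i + 1) =
      ridgeSum S d (i + 1) := by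
  simp only [numFacetsContaining_eq hS]
  refine sum_subset ?_ ?_
  · intro G hG
    have := (mem_facesOfDim.1 hG).2
    rw [faceDim] at this
    exact mem_powersetCard.2 ⟨subset_univ _, by omega⟩
  · intro G hG hG'
    rw [mem_powersetCard] at hG
    have h0 : ({F ∈ S | G ⊆ F} : Finset (Finset V)) = ∅ := by
      refine filter_eq_empty_iff.2 fun F hF hGF => hG' ?_
      refine mem_facesOfDim.2 ⟨?_, by rw [faceDim, hG.2]⟩
      rcases G.eq_empty_or_nonempty with h | h
      · exact Or.inl h
      · have hFΔ : F ∈ facets Δ := hS ▸ hF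
        exact Or.inr (mem_of_subset hFΔ.1 hGF h)
    rw [h0]
    rfl

end Facets

theorem exists_rank_eq {V K : Type*} [Fintype V] [DecidableEq V] [Field K]
    {Δ : PreAbstractSimplicialComplex V} {d : ℕ} (hdim : HasDim Δ d) (hlin : IsLinearTree K Δ) :
    ∃ F : GradedFreeResolution (facetIdeal K Δ), F.IsMinimal ∧ F.rank 1 = (facets Δ).ncard ∧
      ∀ i, F.rank (i + 2) =
        ∑ G ∈ facesOfDim Δ ((d : ℤ) - 1), (numFacetsContaining Δ G).choose (i + 2) := by
  obtain ⟨htree, F, hF, t, ht⟩ := hlin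
  obtain ⟨S, hS⟩ : ∃ S : Finset (Finset V), (S : Set (Finset V)) = facets Δ :=
    ⟨(Set.toFinite _).toFinset, Set.Finite.coe_toFinset _⟩
  have hmem : ∀ {A}, A ∈ S ↔ A ∈ facets Δ := fun {A} => by rw [← hS, Finset.mem_coe]
  have hI : ∀ p ∈ facetIdeal K Δ, MvPolynomial.constantCoeff p = 0 := by
    intro p hp
    rw [facetIdeal_eq_sqfreeIdeal K hS] at hp
    by_contra h0
    obtain ⟨A, hA, hA0⟩ := mem_sqfreeIdeal.1 hp 0 (MvPolynomial.mem_support_iff.2 h0)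
    exact (nonempty_of_mem (hmem.1 hA).1).ne_empty (Finset.subset_empty.1 hA0)
  obtain ⟨C, hC⟩ : ∃ C : LinearChain (sqfreeIdeal K S) t, ∀ i, C.rank i = F.rank (i + 1) := by
    -- The type of `F` mentions the ideal; abstracting its ranks allows the ideal to be rewritten.
    generalize hb : (fun i => F.rank (i + 1)) = b
    have h : ∃ C : LinearChain (facetIdeal K Δ) t, ∀ i, C.rank i = b i :=
      hb ▸ hF.exists_linearChain hI ht
    rw [facetIdeal_eq_sqfreeIdeal K hS] at h
    obtain ⟨C, hC⟩ := h
    exact ⟨C, fun i => (hC i).trans (congrFun hb i).symm⟩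
  have hcardt : ∀ A ∈ S, (A.card : ℤ) = t := fun A hA =>
    C.card_eq (fun A hA H hH h => eq_of_mem_facets (hmem.1 hA) (hmem.1 hH) h) hA
  obtain ⟨⟨G, hG, hGd⟩, hmax⟩ := hdim
  have hGΔ : G ∈ Δ := hG.resolve_left fun h => by
    rw [h, faceDim, Finset.card_empty] at hGd
    omega
  obtain ⟨A, hA, hGA⟩ := exists_facet_superset hGΔ
  -- All facets have `t` elements, and one above a face of top dimension has `d + 1`.
  have htd : t = (d + 1 : ℕ) := by
    have h1 : faceDim A ≤ d := hmax ⟨A, Or.inr hA.1, rfl⟩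
    have h2 := Finset.card_le_card hGA
    have h3 := hcardt A (hmem.2 hA)
    rw [faceDim] at h1 hGd
    push_cast
    omega
  subst htd
  have hcard : ∀ A ∈ S, A.card = d + 1 := fun A hA => by exact_mod_cast hcardt A hA
  have hranks : (C.rank 0 = S.card) ∧ ∀ i, C.rank (i + 1) = ridgeSum S d (i + 2) := by
    obtain ⟨Q, hQ, hQ0, hQi⟩ :=
      exists_idealSeries_eq hcard (htree.hasLeaves hS) (C.linearlyLinked hcard)
    constructor
    · have := C.rank_eq_coeff hQ 0
      rw [hQ0, pow_zero, one_mul] at this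
      exact_mod_cast this
    · intro i
      have := C.rank_eq_coeff hQ (i + 1)
      rw [hQi, ← mul_assoc, ← pow_add, Even.neg_one_pow ⟨i + 1, rfl⟩, one_mul] at this
      exact_mod_cast this
  refine ⟨F, hF, ?_, fun i => ?_⟩
  · rw [← hC 0, hranks.1, ← hS, Set.ncard_coe_finset]
  · rw [← hC (i + 1), hranks.2, sum_facesOfDim_eq_ridgeSum hS]

end FacetIdeal

theorem corollary3p9 {V K : Type*} [Fintype V] [DecidableEq V] [Field K]
    (Δ : AbstractSimplicialComplex V) (d : ℕ)
    (hdim : FacetIdeal.HasDim Δ.toPreAbstractSimplicialComplex d)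
    (hlin : FacetIdeal.IsLinearTree K Δ.toPreAbstractSimplicialComplex) :
    FacetIdeal.IsBettiNumber
        (FacetIdeal.facetIdeal K Δ.toPreAbstractSimplicialComplex) 1
        (FacetIdeal.facets Δ.toPreAbstractSimplicialComplex).ncard ∧
      ∀ i : ℕ, 2 ≤ i →
        FacetIdeal.IsBettiNumber
          (FacetIdeal.facetIdeal K Δ.toPreAbstractSimplicialComplex) i
          (∑ G ∈ FacetIdeal.facesOfDim Δ.toPreAbstractSimplicialComplex ((d : ℤ) - 1),
            (FacetIdeal.numFacetsContaining Δ.toPreAbstractSimplicialComplex G).choose i) := by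
  obtain ⟨F, hF, h1, h2⟩ := FacetIdeal.exists_rank_eq hdim hlin
  refine ⟨⟨⟨F, hF⟩, fun F' hF' => (hF'.rank_eq hF 1).trans h1⟩, fun i hi => ?_⟩
  obtain ⟨i, rfl⟩ := Nat.exists_eq_add_of_le' hi
  exact ⟨⟨F, hF⟩, fun F' hF' => (hF'.rank_eq hF _).trans (h2 i)⟩
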